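/- For a non-integer real number $\beta>1$ and a sequence $E=(E(0),E(1),\dots)\in\{0,1\}^{\mathbb N}$, let $I_\beta(x)=\lfloor\beta x\rfloor$ and define the generalized $\beta$-map $\tau_{\beta,E}:[0,1]\to[0,1]$ by $$\tau_{\beta,E}(x)=E(I_\beta(x))+(-1)^{E(I_\beta(x))}\{\beta x\},$$ where $\{y\}$ is the fractional part of $y$. Put $d_n=E(I_\beta(\tau_{\beta,E}^n(1)))+I_\beta(\tau_{\beta,E}^n(1))$, $e_n=(-1)^{E(I_\beta(\tau_{\beta,E}^n(1)))}$, $s_n=\prod_{i=0}^{n-1}e_i$ (so $s_0=1$), and $EP=\{1/\beta,\dots,\lfloor\beta\rfloor/\beta\}$. The number $\beta$ is a generalized Parry number with respect to $E$ if the orbit $\{\tau_{\beta,E}^n(1):n\ge0\}$ is finite, and it is simple with respect to $E$ if $\tau_{\beta,E}^n(1)\in EP$ for some $n\ge1$. Let $$\phi_{\beta,E}(z)=\sum_{n=0}^{N-1}s_nd_nz^{n+1}+\beta\,\tau_{\beta,E}^N(1)\,s_Nz^{N+1},\qquad N=\min\{n\ge1:\tau_{\beta,E}^n(1)\in EP\},$$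 if $\beta$ is simple, and $\phi_{\beta,E}(z)=\sum_{n=0}^\infty s_nd_nz^{n+1}$ otherwise. Let $\Phi(E)$ (respectively $\hat\Phi(E)$) be the closure in $\mathbb C$ of the set of all Galois conjugates over $\mathbb Q$, other than $\beta$ itself, of the simple generalized Parry numbers (respectively of all generalized Parry numbers) $\beta$ with respect to $E$. Let $\Phi^*(E)$ be the closure of the set of all $z^{-1}$ such that, for some non-integer $\beta>1$, $z\ne\beta^{-1}$ is a zero of $1-\phi_{\beta,E}$; here $\phi_{\beta,E}$ is evaluated where its series converges, and through its rational extension where it has one. Let $\mathbb D$ be the open unit disk in $\mathbb C$, let $\mathcal G_{[-1,1]}$ be the set of $z\in\mathbb D$ for which there are $a_1,a_2,\dots\in[-1,1]$ with $1+\sum_{n\ge1}a_nz^n=0$, and let $\mathcal G_{[-1,1]}^{-1}=\{z^{-1}:z\in\mathcal G_{[-1,1]}\}$. Let $E_{alt}=(0,1,0,1,0,1,\dots)$. Then $$\Phi(E_{alt})=\hat\Phi(E_{alt})=\Phi^*(E_{alt})=\operatorname{clos}(\mathbb D)\cup\mathcal G_{[-1,1]}^{-1},$$ and, moreover, $\Phi(E_{alt})=\bigcup_{E\in\{0,1\}^{\mathbb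 N}}\Phi(E)$. -/

import Mathlib

namespace GenBeta

noncomputable section

/-- The standing assumption on the base: `β > 1` is not an integer. -/
def Admissible (β : ℝ) : Prop := 1 < β ∧ ∀ n : ℤ, β ≠ n

/-- `I_β(x) = [β x]`, for `x ∈ [0,1]`. -/
def branch (β x : ℝ) : ℕ := ⌊β * x⌋₊

/-- The generalized `β`-map `τ_{β,E}(x) = E(I_β(x)) + (-1)^{E(I_β(x))} {β x}` of a 0-1 sequence `E`.
It is only ever used on `[0,1]`, which it maps into itself (`tau_mem_Icc`). -/
def tau (β : ℝ) (E : ℕ → Fin 2) (x : ℝ) : ℝ :=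
  ((E (branch β x) : ℕ) : ℝ) + (-1) ^ (E (branch β x) : ℕ) * Int.fract (β * x)

theorem tau_mem_Icc (β : ℝ) (E : ℕ → Fin 2) (x : ℝ) : tau β E x ∈ Set.Icc (0 : ℝ) 1 := by
  have h0 := Int.fract_nonneg (β * x)
  have h1 := Int.fract_lt_one (β * x)
  unfold tau
  generalize E (branch β x) = e
  fin_cases e <;> constructor <;> simp <;> linarith

/-- `orbit β E n = τ_{β,E}^n(1)`. -/
def orbit (β : ℝ) (E : ℕ → Fin 2) (n : ℕ) : ℝ := (tau β E)^[n] 1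

/-- The digit `d_n(β,E,1)`. -/
def digit (β : ℝ) (E : ℕ → Fin 2) (n : ℕ) : ℕ :=
  (E (branch β (orbit β E n)) : ℕ) + branch β (orbit β E n)

/-- The sign `e_n(β,E,1)`. -/
def sgn (β : ℝ) (E : ℕ → Fin 2) (n : ℕ) : ℤ := (-1) ^ (E (branch β (orbit β E n)) : ℕ)

/-- The cumulative sign `s_n(β,E,1)`, with `s_0 = 1`. -/
def cumSgn (β : ℝ) (E : ℕ → Fin 2) (n : ℕ) : ℤ := ∏ i ∈ Finset.range n, sgn β E i

/-- The interior end points `{1/β, …, [β]/β}` of the monotonicity intervals. -/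
def EP (β : ℝ) : Set ℝ := {x | ∃ k : ℕ, 1 ≤ k ∧ k ≤ ⌊β⌋₊ ∧ x = k / β}

/-- `β` is a generalized Parry number with respect to `E`: the orbit of `1` is a finite set. -/
def IsGenParry (β : ℝ) (E : ℕ → Fin 2) : Prop :=
  Admissible β ∧ (Set.range (orbit β E)).Finite

/-- `β` is simple with respect to `E`: the orbit of `1` eventually falls into `EP`. -/
def IsSimple (β : ℝ) (E : ℕ → Fin 2) : Prop :=
  Admissible β ∧ ∃ n : ℕ, 1 ≤ n ∧ orbit β E n ∈ EP β

/-- `N = min {n ≥ 1 ; τ_{β,E}^n(1) ∈ EP}`; used only when this set is non-empty. -/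
def firstHit (β : ℝ) (E : ℕ → Fin 2) : ℕ := sInf {n : ℕ | 1 ≤ n ∧ orbit β E n ∈ EP β}

open Classical in
/-- The formal power series `φ_{τ_{β,E}}`: a polynomial if `β` is simple, and
`∑_{n ≥ 0} s_n d_n z^{n+1}` otherwise. -/
def phi (β : ℝ) (E : ℕ → Fin 2) : PowerSeries ℂ :=
  if IsSimple β E then
    (∑ n ∈ Finset.range (firstHit β E),
      PowerSeries.C ((cumSgn β E n : ℂ) * (digit β E n : ℂ)) * PowerSeries.X ^ (n + 1))
    + PowerSeries.C (((β * orbit β E (firstHit β E) : ℝ) : ℂ) * (cumSgn β E (firstHit β E) : ℂ))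
      * PowerSeries.X ^ (firstHit β E + 1)
  else
    PowerSeries.X * PowerSeries.mk (fun n => (cumSgn β E n : ℂ) * (digit β E n : ℂ))

/-- `z` is a zero of the function defined by the power series `F`: either `F` converges at `z`
with sum `0`, or `F` extends to a rational function `P / Q` (in lowest terms) that vanishes
at `z`. -/
def IsZeroOf (F : PowerSeries ℂ) (z : ℂ) : Prop :=
  HasSum (fun n : ℕ => PowerSeries.coeff n F * z ^ n) 0 ∨
  ∃ P Q : Polynomial ℂ, IsCoprime P Q ∧ (Q : PowerSeries ℂ) * F = (P : PowerSeries ℂ) ∧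
    P.eval z = 0

/-- The Galois conjugates of an algebraic real number `β`, other than `β` itself: the complex
numbers `z ≠ β` with the same minimal polynomial over `ℚ`. -/
def galoisConjugates (β : ℝ) : Set ℂ :=
  {z | IsAlgebraic ℚ β ∧ IsConjRoot ℚ (β : ℂ) z ∧ z ≠ (β : ℂ)}

/-- `Φ(E)`. -/
def Phi (E : ℕ → Fin 2) : Set ℂ :=
  closure {z | ∃ β : ℝ, IsSimple β E ∧ z ∈ galoisConjugates β}

/-- `Φ̂(E)`. -/
def PhiHat (E : ℕ → Fin 2) : Set ℂ :=
  closure {z | ∃ β : ℝ, IsGenParry β E ∧ z ∈ galoisConjugates β}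

/-- `Φ*(E)`: the closure of the set of reciprocals of the zeros of `1 - φ_{τ_{β,E}}` other than
the trivial zero `1/β`, for all admissible `β`. -/
def PhiStar (E : ℕ → Fin 2) : Set ℂ :=
  closure {w | ∃ β : ℝ, Admissible β ∧
    ∃ z : ℂ, IsZeroOf (1 - phi β E) z ∧ z ≠ ((β : ℂ))⁻¹ ∧ w = z⁻¹}

/-- `𝓕_I`: the power series `1 + ∑_{n ≥ 1} a_n z^n` with all `a_n ∈ I`. -/
def FF (I : Set ℝ) : Set (PowerSeries ℝ) :=
  {f | PowerSeries.coeff 0 f = 1 ∧ ∀ n : ℕ, 1 ≤ n → PowerSeries.coeff n f ∈ I}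

/-- `𝓖_I`: the zeros of members of `𝓕_I` in the open unit disk. -/
def GG (I : Set ℝ) : Set ℂ :=
  {z | z ∈ Metric.ball (0 : ℂ) 1 ∧
    ∃ f ∈ FF I, HasSum (fun n : ℕ => ((PowerSeries.coeff n f : ℝ) : ℂ) * z ^ n) 0}

/-- `A^{-1} = {z^{-1} ; z ∈ A}`. -/
def invSet (A : Set ℂ) : Set ℂ := (fun z : ℂ => z⁻¹) '' A

/-- `E_alt = (0,1,0,1,…)`. -/
def Ealt : ℕ → Fin 2 := fun n => if Even n then 0 else 1

end

end GenBeta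

namespace GenBeta

/-! All four sets are squeezed between `bigSet` and `Phi Ealt`.

Upper bound, for every `E`: the signed orbit `u n = s_n τ^n(1)` satisfies `u (n+1) = β u n - s_n
d_n`, so `1 - φ(z) = (1 - β z) ∑ u n z^n` with `|u n| ≤ 1` (cut off after the first hit of `EP` if
`β` is simple). A zero in the disk other than `1/β` thus lies in `GG [-1,1]`. For a conjugate of a
generalized Parry number, the same recursion is compared with its conjugate. Compactness makes
`bigSet` closed.

Lower bound, for `Ealt`: up to sign, `τ` is `u ↦ β u - 2m`, so Horner's scheme of a monic integer
polynomial with even lower coefficients is a signed orbit as long as its values at `β` stay in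
`(-1,1)`. With a huge second coefficient these values can be prescribed approximately, and
Eisenstein at 2 makes all other roots conjugates of `β`. Dividing by `X - β` leaves a polynomial
whose coefficients are these values. Hence roots of all monic polynomials with lower coefficients in
`[-1,1]` lie in `Phi Ealt` (`mem_Phi_Ealt_of_root`), and such roots are dense in `bigSet`. -/

/-! ### Evaluating power series and linear recursions. -/

open PowerSeries in
/-- Evaluation of a product of two absolutely convergent power series. -/
theorem hasSum_coeff_mul {F G : PowerSeries ℂ} {z : ℂ}
    (hF : Summable fun n => ‖coeff n F * z ^ n‖) (hG : Summable fun n => ‖coeff n G * z ^ n‖) :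
    HasSum (fun n => coeff n (F * G) * z ^ n)
      ((∑' n, coeff n F * z ^ n) * ∑' n, coeff n G * z ^ n) := by
  have key : ∀ n, ∑ kl ∈ Finset.HasAntidiagonal.antidiagonal n,
      (coeff kl.1 F * z ^ kl.1) * (coeff kl.2 G * z ^ kl.2) = coeff n (F * G) * z ^ n := by
    intro n
    rw [coeff_mul, Finset.sum_mul]
    refine Finset.sum_congr rfl fun kl hkl => ?_
    rw [← Finset.HasAntidiagonal.mem_antidiagonal.mp hkl, pow_add]
    ring
  rw [tsum_mul_tsum_eq_tsum_sum_antidiagonal_of_summable_norm hF hG]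
  have hs := (summable_norm_sum_mul_antidiagonal_of_summable_norm hF hG).of_norm
  simp only [key] at hs ⊢
  exact hs.hasSum

theorem summable_norm_coeff_of_eventually_zero {F : PowerSeries ℂ} {N : ℕ}
    (hF : ∀ n, N ≤ n → PowerSeries.coeff n F = 0) (z : ℂ) :
    Summable fun n => ‖PowerSeries.coeff n F * z ^ n‖ := by
  refine summable_of_ne_finset_zero (s := Finset.range N) fun n hn => ?_
  rw [hF n (by simpa using hn)]
  simp

theorem summable_norm_polynomial (P : Polynomial ℂ) (z : ℂ) :
    Summable fun n => ‖PowerSeries.coeff n (P : PowerSeries ℂ) * z ^ n‖ := by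
  refine summable_norm_coeff_of_eventually_zero (N := P.natDegree + 1) (fun n hn => ?_) z
  rw [Polynomial.coeff_coe]
  exact Polynomial.coeff_eq_zero_of_natDegree_lt (by omega)

theorem tsum_polynomial (P : Polynomial ℂ) (z : ℂ) :
    ∑' n, PowerSeries.coeff n (P : PowerSeries ℂ) * z ^ n = P.eval z := by
  rw [Polynomial.eval_eq_sum_range, tsum_eq_sum (s := Finset.range (P.natDegree + 1))]
  · simp
  · intro n hn
    rw [Polynomial.coeff_coe, Polynomial.coeff_eq_zero_of_natDegree_lt (by simpa using hn), zero_mul]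

theorem summable_norm_of_bounded {F : PowerSeries ℂ} {C : ℝ}
    (hF : ∀ n, ‖PowerSeries.coeff n F‖ ≤ C) {z : ℂ} (hz : ‖z‖ < 1) :
    Summable fun n => ‖PowerSeries.coeff n F * z ^ n‖ := by
  refine Summable.of_nonneg_of_le (fun _ => norm_nonneg _) (fun n => ?_)
    ((summable_geometric_of_lt_one (norm_nonneg z) hz).mul_left C)
  rw [norm_mul, norm_pow]
  exact mul_le_mul_of_nonneg_right (hF n) (by positivity)

/-- A recursion `v (n+1) = b * v n - c n` is a factorization of the generating series. -/
theorem one_sub_X_mul_mk_eq {b : ℂ} {c v : ℕ → ℂ} (h0 : v 0 = 1)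
    (hs : ∀ n, v (n + 1) = b * v n - c n) :
    1 - PowerSeries.X * PowerSeries.mk c =
      ((1 - Polynomial.C b * Polynomial.X : Polynomial ℂ) : PowerSeries ℂ) * PowerSeries.mk v := by
  ext n
  rw [Polynomial.coe_sub, Polynomial.coe_mul, Polynomial.coe_C, Polynomial.coe_X,
    Polynomial.coe_one, sub_mul, one_mul, mul_assoc]
  cases n with
  | zero => simp [h0]
  | succ n =>
    simp only [map_sub, PowerSeries.coeff_succ_X_mul, PowerSeries.coeff_mk,
      PowerSeries.coeff_C_mul, PowerSeries.coeff_one, hs]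
    simp

/-- Used with `b = β` to isolate the trivial zero, and with `b = z⁻¹`, where the factor `1 - b * z`
kills the sum. -/
theorem hasSum_one_sub_of_recursion {b z : ℂ} {c v : ℕ → ℂ} (h0 : v 0 = 1)
    (hs : ∀ n, v (n + 1) = b * v n - c n)
    (hv : Summable fun n => ‖PowerSeries.coeff n (PowerSeries.mk v) * z ^ n‖) :
    HasSum (fun n => PowerSeries.coeff n (1 - PowerSeries.X * PowerSeries.mk c) * z ^ n)
      ((1 - b * z) * ∑' n, v n * z ^ n) := by
  have h := hasSum_coeff_mul (summable_norm_polynomial (1 - Polynomial.C b * Polynomial.X) z) hv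
  rw [tsum_polynomial, ← one_sub_X_mul_mk_eq h0 hs] at h
  simpa using h

/-! ### The signed orbit as integer polynomials in `β`. -/

/-- The polynomials of Horner's scheme: `X ^ n - c 0 * X ^ (n - 1) - ⋯ - c (n - 1)`. -/
noncomputable def horner {R : Type*} [CommRing R] (c : ℕ → R) : ℕ → Polynomial R
  | 0 => 1
  | n + 1 => Polynomial.X * horner c n - Polynomial.C (c n)

/-- The signed orbit `s_n τ^n(1)` of `1`. -/
noncomputable def signedOrbit (β : ℝ) (E : ℕ → Fin 2) (n : ℕ) : ℝ := cumSgn β E n * orbit β E n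

theorem orbit_succ (β : ℝ) (E : ℕ → Fin 2) (n : ℕ) :
    orbit β E (n + 1) = tau β E (orbit β E n) := by
  simp [orbit, Function.iterate_succ_apply']

theorem orbit_mem_Icc (β : ℝ) (E : ℕ → Fin 2) (n : ℕ) : orbit β E n ∈ Set.Icc (0 : ℝ) 1 := by
  cases n with
  | zero => simp [orbit]
  | succ n => rw [orbit_succ]; exact tau_mem_Icc ..

theorem natCast_branch {β x : ℝ} (h : 0 ≤ β * x) : (branch β x : ℝ) = β * x - Int.fract (β * x) := by
  rw [branch, natCast_floor_eq_intCast_floor h, Int.self_sub_fract]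

theorem cumSgn_eq (β : ℝ) (E : ℕ → Fin 2) (n : ℕ) : cumSgn β E n = 1 ∨ cumSgn β E n = -1 := by
  induction n with
  | zero => simp [cumSgn]
  | succ n ih =>
    have h1 : sgn β E n = 1 ∨ sgn β E n = -1 := neg_one_pow_eq_or ..
    have h2 : cumSgn β E (n + 1) = cumSgn β E n * sgn β E n := Finset.prod_range_succ ..
    rcases h1 with h1 | h1 <;> rcases ih with ih | ih <;> simp [h2, h1, ih]

@[simp]
theorem signedOrbit_zero (β : ℝ) (E : ℕ → Fin 2) : signedOrbit β E 0 = 1 := by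
  simp [signedOrbit, cumSgn, orbit]

theorem signedOrbit_succ {β : ℝ} (hβ : 0 ≤ β) (E : ℕ → Fin 2) (n : ℕ) :
    signedOrbit β E (n + 1) =
      β * signedOrbit β E n - ((cumSgn β E n * digit β E n : ℤ) : ℝ) := by
  have h2 : cumSgn β E (n + 1) = cumSgn β E n * sgn β E n := Finset.prod_range_succ ..
  have hb := natCast_branch (mul_nonneg hβ (orbit_mem_Icc β E n).1)
  simp only [signedOrbit, h2, orbit_succ, tau, sgn, digit]
  push_cast
  rw [hb]
  generalize Int.fract (β * orbit β E n) = t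
  generalize E (branch β (orbit β E n)) = e
  fin_cases e <;> simp <;> ring

theorem abs_signedOrbit (β : ℝ) (E : ℕ → Fin 2) (n : ℕ) : |signedOrbit β E n| = orbit β E n := by
  have h := (orbit_mem_Icc β E n).1
  rcases cumSgn_eq β E n with h1 | h1 <;> simp [signedOrbit, h1, abs_of_nonneg h]

theorem aeval_horner_digits {β : ℝ} (hβ : 0 ≤ β) (E : ℕ → Fin 2) (n : ℕ) :
    Polynomial.aeval β (horner (fun n => cumSgn β E n * (digit β E n : ℤ)) n) =
      signedOrbit β E n := by
  induction n with
  | zero => simp [horner]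
  | succ n ih => simp [horner, ih, signedOrbit_succ hβ]

theorem aeval_eq_zero_of_mem_galoisConjugates {β : ℝ} {z : ℂ} (hz : z ∈ galoisConjugates β)
    (p : Polynomial ℤ) (hp : Polynomial.aeval β p = 0) : Polynomial.aeval z p = 0 := by
  have h1 : Polynomial.aeval (β : ℂ) (p.map (algebraMap ℤ ℚ)) = 0 := by
    have h2 : Polynomial.aeval (algebraMap ℝ ℂ β) p = 0 := by
      rw [Polynomial.aeval_algebraMap_apply, hp, map_zero]
    rw [Polynomial.aeval_map_algebraMap]
    exact h2
  rw [← Polynomial.aeval_map_algebraMap ℚ]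
  have h3 := minpoly.dvd ℚ _ h1
  rw [hz.2.1] at h3
  exact Polynomial.aeval_eq_zero_of_dvd_aeval_eq_zero h3 (minpoly.aeval ℚ z)

theorem orbit_mem_EP_firstHit {β : ℝ} {E : ℕ → Fin 2} (h : IsSimple β E) :
    1 ≤ firstHit β E ∧ orbit β E (firstHit β E) ∈ EP β :=
  Nat.sInf_mem (s := {n : ℕ | 1 ≤ n ∧ orbit β E n ∈ EP β}) h.2

open Classical in
/-- The coefficients of `φ_{β,E}`, shifted by one. -/
noncomputable def phiCoeff (β : ℝ) (E : ℕ → Fin 2) (n : ℕ) : ℝ :=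
  if IsSimple β E then
    if n < firstHit β E then ((cumSgn β E n * digit β E n : ℤ) : ℝ)
    else if n = firstHit β E then β * signedOrbit β E n else 0
  else ((cumSgn β E n * digit β E n : ℤ) : ℝ)

open Classical in
/-- The signed orbit, cut off after the first visit to `EP` if there is one. -/
noncomputable def cutOrbit (β : ℝ) (E : ℕ → Fin 2) (n : ℕ) : ℝ :=
  if IsSimple β E ∧ firstHit β E < n then 0 else signedOrbit β E n

theorem phi_eq (β : ℝ) (E : ℕ → Fin 2) :
    phi β E = PowerSeries.X * PowerSeries.mk fun n => (phiCoeff β E n : ℂ) := by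
  by_cases h : IsSimple β E
  · ext n
    cases n with
    | zero => simp [phi, h]
    | succ n =>
      simp only [phi, h, if_true, map_add, map_sum, PowerSeries.coeff_C_mul_X_pow,
        PowerSeries.coeff_succ_X_mul, PowerSeries.coeff_mk, phiCoeff, add_left_inj,
        Finset.sum_ite_eq, Finset.mem_range]
      rcases lt_trichotomy n (firstHit β E) with h1 | h1 | h1
      · simp [h1, h1.ne]
      · simp [h1, signedOrbit]; ring
      · simp [h1.not_gt, h1.ne']
  · simp [phi, phiCoeff, h]

theorem cutOrbit_succ {β : ℝ} (hβ : 0 ≤ β) (E : ℕ → Fin 2) (n : ℕ) :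
    cutOrbit β E (n + 1) = β * cutOrbit β E n - phiCoeff β E n := by
  by_cases h : IsSimple β E
  · simp only [cutOrbit, phiCoeff, h, true_and, if_true]
    rcases lt_trichotomy n (firstHit β E) with h1 | h1 | h1
    · rw [if_neg (by omega), if_neg (by omega), if_pos h1, signedOrbit_succ hβ]
    · simp [h1]
    · rw [if_pos (by omega), if_pos h1, if_neg (by omega), if_neg (by omega)]; simp
  · simp only [cutOrbit, phiCoeff, h, false_and, if_false]
    exact signedOrbit_succ hβ E n

theorem abs_cutOrbit_le (β : ℝ) (E : ℕ → Fin 2) (n : ℕ) : |cutOrbit β E n| ≤ 1 := by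
  unfold cutOrbit
  split_ifs
  · simp
  · rw [abs_signedOrbit]; exact (orbit_mem_Icc β E n).2

theorem mem_GG_of_hasSum {v : ℕ → ℝ} (h0 : v 0 = 1) (hv : ∀ n, |v n| ≤ 1) {z : ℂ} (hz : ‖z‖ < 1)
    (h : ∑' n, (v n : ℂ) * z ^ n = 0) : z ∈ GG (Set.Icc (-1 : ℝ) 1) := by
  refine ⟨by simpa using hz, PowerSeries.mk v, ⟨by simpa using h0, fun n _ => ?_⟩, ?_⟩
  · rw [PowerSeries.coeff_mk]; exact abs_le.mp (hv n)
  · have hs := summable_norm_of_bounded (F := PowerSeries.mk fun n => (v n : ℂ)) (C := 1)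
      (fun n => by simpa using hv n) hz
    simp only [PowerSeries.coeff_mk] at hs ⊢
    rw [← h]
    exact hs.of_norm.hasSum

/-! ### Upper bound: zeros and conjugates. -/

/-- The set that all the closures in question are contained in. -/
def bigSet : Set ℂ := closure (Metric.ball (0 : ℂ) 1) ∪ invSet (GG (Set.Icc (-1 : ℝ) 1))

theorem mem_bigSet_of_norm_le {z : ℂ} (hz : ‖z‖ ≤ 1) : z ∈ bigSet := by
  left
  rw [closure_ball _ one_ne_zero]
  simpa using hz

theorem inv_mem_bigSet_of_isZeroOf {β : ℝ} (hβ : 1 < β) {E : ℕ → Fin 2} {z : ℂ}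
    (hz : IsZeroOf (1 - phi β E) z) (hne : z ≠ (β : ℂ)⁻¹) : z⁻¹ ∈ bigSet := by
  rcases le_or_gt 1 ‖z‖ with h1 | h1
  · exact mem_bigSet_of_norm_le (by rw [norm_inv]; exact inv_le_one_of_one_le₀ h1)
  refine Or.inr ⟨z, ?_, rfl⟩
  have hs := summable_norm_of_bounded (F := PowerSeries.mk fun n => (cutOrbit β E n : ℂ)) (C := 1)
    (fun n => by simpa using abs_cutOrbit_le β E n) h1
  have h00 : cutOrbit β E 0 = 1 := by simp [cutOrbit]
  have h0 : (cutOrbit β E 0 : ℂ) = 1 := by simp [h00]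
  have hrec : ∀ n, (cutOrbit β E (n + 1) : ℂ) = β * cutOrbit β E n - (phiCoeff β E n : ℂ) := by
    intro n; rw [cutOrbit_succ (by linarith)]; push_cast; rfl
  have hsum := hasSum_one_sub_of_recursion h0 hrec hs
  rw [← phi_eq] at hsum
  have hbz : 1 - (β : ℂ) * z ≠ 0 := by
    intro h
    exact hne (eq_inv_of_mul_eq_one_right (sub_eq_zero.mp h).symm)
  have hzero : (1 - (β : ℂ) * z) * ∑' n, (cutOrbit β E n : ℂ) * z ^ n = 0 := by
    rcases hz with hz | ⟨P, Q, hPQ, hQF, hP⟩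
    · exact hsum.unique hz
    -- With `Q (1 - φ) = P`, evaluation gives `Q(z) (1 - β z) V(z) = P(z) = 0`, where `V` is the
    -- series of `cutOrbit`; coprimality excludes `Q(z) = 0`.
    · have hfac : 1 - phi β E = _ := (congrArg (1 - ·) (phi_eq β E)).trans
        (one_sub_X_mul_mk_eq (v := fun n => (cutOrbit β E n : ℂ)) h0 hrec)
      have h2 := hasSum_coeff_mul (summable_norm_polynomial
        (Q * (1 - Polynomial.C (β : ℂ) * Polynomial.X)) z) hs
      rw [Polynomial.coe_mul, mul_assoc, ← hfac, hQF, ← Polynomial.coe_mul] at h2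
      have h3 := h2.tsum_eq
      rw [tsum_polynomial, tsum_polynomial, hP] at h3
      have hQ : Q.eval z ≠ 0 := by
        obtain ⟨a, b, hab⟩ := hPQ
        intro hQ
        have := congrArg (Polynomial.eval z) hab
        simp [hP, hQ] at this
      simp only [Polynomial.eval_mul, Polynomial.eval_sub, Polynomial.eval_one,
        Polynomial.eval_C, Polynomial.eval_X, PowerSeries.coeff_mk, mul_assoc] at h3
      exact (mul_eq_zero.mp h3.symm).resolve_left hQ
  exact mem_GG_of_hasSum h00 (abs_cutOrbit_le β E) h1 ((mul_eq_zero.mp hzero).resolve_left hbz)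

/-- Replacing `β` by `z` in the polynomials of the signed orbit gives a sequence `y` that obeys the
same recursion with `z` for `β`. Conjugation preserves equalities between orbit values, so a finite
orbit makes `y` bounded. At `z⁻¹` both factorizations of `1 - ∑ c n X^(n+1)` converge: one vanishes,
hence so does the other. -/
theorem mem_bigSet_of_mem_galoisConjugates {β : ℝ} {E : ℕ → Fin 2} (hβ : IsGenParry β E) {z : ℂ}
    (hz : z ∈ galoisConjugates β) : z ∈ bigSet := by
  rcases le_or_gt ‖z‖ 1 with h1 | h1
  · exact mem_bigSet_of_norm_le h1
  have hβ0 : 0 ≤ β := by linarith [hβ.1.1]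
  have hz0 : z ≠ 0 := by rintro rfl; simp at h1; linarith
  have hzi : ‖z⁻¹‖ < 1 := by rw [norm_inv]; exact inv_lt_one_of_one_lt₀ h1
  refine Or.inr ⟨z⁻¹, ?_, inv_inv z⟩
  set c : ℕ → ℤ := fun n => cumSgn β E n * (digit β E n : ℤ) with hc
  set y : ℕ → ℂ := fun n => Polynomial.aeval z (horner c n) with hy
  have hfac : ∀ m n, signedOrbit β E m = signedOrbit β E n → y m = y n := by
    intro m n hmn
    have := aeval_eq_zero_of_mem_galoisConjugates hz (horner c m - horner c n) (by
      rw [map_sub, aeval_horner_digits hβ0, aeval_horner_digits hβ0, hmn, sub_self])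
    rwa [map_sub, sub_eq_zero] at this
  have hfin : (Set.range (signedOrbit β E)).Finite := by
    refine (hβ.2.union (hβ.2.image Neg.neg)).subset ?_
    rintro _ ⟨n, rfl⟩
    rcases cumSgn_eq β E n with h | h
    · exact Or.inl ⟨n, by simp [signedOrbit, h]⟩
    · exact Or.inr ⟨_, ⟨n, rfl⟩, by simp [signedOrbit, h]⟩
  obtain ⟨g, hg⟩ : ∃ g : ℝ → ℂ, y = g ∘ signedOrbit β E :=
    ⟨_, ((Function.FactorsThrough.extend_comp (f := signedOrbit β E) (g := y)
      0 (fun m n h => hfac m n h))).symm⟩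
  have hyfin : (Set.range y).Finite := by rw [hg, Set.range_comp]; exact hfin.image _
  obtain ⟨C, hC⟩ := hyfin.isBounded.exists_norm_le
  have hys := summable_norm_of_bounded (F := PowerSeries.mk y) (C := C)
    (fun n => by simpa using hC _ ⟨n, rfl⟩) hzi
  have hsum1 := hasSum_one_sub_of_recursion (b := z) (c := fun n => (c n : ℂ)) (v := y)
    (by simp [hy, horner]) (fun n => by simp [hy, horner]) hys
  have hus := summable_norm_of_bounded (F := PowerSeries.mk fun n => (signedOrbit β E n : ℂ))
    (C := 1) (fun n => by
      simpa [abs_signedOrbit] using (orbit_mem_Icc β E n).2) hzi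
  have hsum2 := hasSum_one_sub_of_recursion (b := (β : ℂ)) (c := fun n => (c n : ℂ))
    (v := fun n => (signedOrbit β E n : ℂ)) (by simp)
    (fun n => by rw [signedOrbit_succ hβ0]; simp [hc]) hus
  have h := hsum1.unique hsum2
  rw [mul_inv_cancel₀ hz0, sub_self, zero_mul] at h
  have hbz : 1 - (β : ℂ) * z⁻¹ ≠ 0 := by
    intro h
    apply hz.2.2
    rw [sub_eq_zero, eq_comm, mul_inv_eq_one₀ hz0] at h
    exact h.symm
  exact mem_GG_of_hasSum (signedOrbit_zero β E)
    (fun n => by rw [abs_signedOrbit]; exact (orbit_mem_Icc β E n).2) hzi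
    ((mul_eq_zero.mp h.symm).resolve_left hbz)

/-! ### Simple numbers: finite orbits, and conjugates as zeros of `1 - φ`. -/

theorem tau_zero (β : ℝ) (E : ℕ → Fin 2) : tau β E 0 = 0 ∨ tau β E 0 = 1 := by
  unfold tau
  generalize E _ = e
  fin_cases e <;> simp

theorem tau_of_mem_EP {β : ℝ} (hβ : β ≠ 0) (E : ℕ → Fin 2) {x : ℝ} (hx : x ∈ EP β) :
    tau β E x = 0 ∨ tau β E x = 1 := by
  obtain ⟨k, -, -, rfl⟩ := hx
  unfold tau
  rw [mul_div_cancel₀ _ hβ, Int.fract_natCast]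
  generalize E _ = e
  fin_cases e <;> simp

theorem IsSimple.isGenParry {β : ℝ} {E : ℕ → Fin 2} (h : IsSimple β E) : IsGenParry β E := by
  refine ⟨h.1, ?_⟩
  obtain ⟨N, -, hN⟩ := h.2
  have hβ : β ≠ 0 := by have := h.1.1; positivity
  have hfin : (insert 0 (orbit β E '' Set.Iic N)).Finite :=
    ((Set.finite_Iic N).image _).insert _
  refine hfin.subset ?_
  rintro _ ⟨n, rfl⟩
  have h1 : (1 : ℝ) ∈ insert 0 (orbit β E '' Set.Iic N) := Or.inr ⟨0, by simp, by simp [orbit]⟩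
  have h01 : ∀ x : ℝ, x = 0 ∨ x = 1 → x ∈ insert 0 (orbit β E '' Set.Iic N) := by
    rintro x (rfl | rfl)
    · exact Or.inl rfl
    · exact h1
  induction n with
  | zero => simpa [orbit] using h1
  | succ n ih =>
    rw [orbit_succ]
    rcases ih with ih | ⟨i, hi, hin⟩
    · rw [ih]; exact h01 _ (tau_zero β E)
    · rw [← hin]
      rcases (show i ≤ N from hi).lt_or_eq with hlt | rfl
      · rw [← orbit_succ]; exact Or.inr ⟨i + 1, hlt, rfl⟩
      · exact h01 _ (tau_of_mem_EP hβ E hN)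

/-- At the first hit `β τ^N(1)` is an integer, so the termination of the recursion is an integer
polynomial relation in `β` and carries over to `z`. -/
theorem isZeroOf_inv_of_mem_galoisConjugates {β : ℝ} {E : ℕ → Fin 2} (hβ : IsSimple β E) {z : ℂ}
    (hz : z ∈ galoisConjugates β) (hz0 : z ≠ 0) : IsZeroOf (1 - phi β E) z⁻¹ := by
  left
  have hβ0 : 0 < β := by linarith [hβ.1.1]
  set N := firstHit β E with hN
  set c : ℕ → ℤ := fun n => cumSgn β E n * (digit β E n : ℤ) with hc
  set v : ℕ → ℂ := fun n => if N < n then 0 else Polynomial.aeval z (horner c n) with hv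
  obtain ⟨k, -, -, hk⟩ := (orbit_mem_EP_firstHit hβ).2
  have hβN : β * signedOrbit β E N = ((cumSgn β E N * k : ℤ) : ℝ) := by
    rw [signedOrbit, hk]; push_cast; field_simp
  have hzN : z * Polynomial.aeval z (horner c N) = ((cumSgn β E N * k : ℤ) : ℂ) := by
    have := aeval_eq_zero_of_mem_galoisConjugates hz
      (Polynomial.X * horner c N - Polynomial.C (cumSgn β E N * (k : ℤ))) (by
        rw [map_sub, map_mul, aeval_horner_digits hβ0.le, Polynomial.aeval_X, hβN]; simp)
    rw [map_sub, map_mul, Polynomial.aeval_X, sub_eq_zero] at this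
    rw [this]; simp
  have hrec : ∀ n, v (n + 1) = z * v n - (phiCoeff β E n : ℂ) := by
    intro n
    simp only [hv, phiCoeff, hβ, if_true, ← hN]
    rcases lt_trichotomy n N with h1 | h1 | h1
    · rw [if_neg (by omega), if_neg (by omega), if_pos h1]
      simp [horner, hc]
    · subst h1
      rw [if_pos (by omega), if_neg (by omega), if_neg (by omega), if_pos rfl, hzN, hβN]
      simp
    · rw [if_pos (by omega), if_pos h1, if_neg (by omega), if_neg (by omega)]; simp
  have hsum := hasSum_one_sub_of_recursion (z := z⁻¹) (by simp [hv, horner]) hrec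
    (summable_norm_coeff_of_eventually_zero (N := N + 1) (fun n hn => by
      rw [PowerSeries.coeff_mk]; exact if_pos (by omega)) _)
  rwa [mul_inv_cancel₀ hz0, sub_self, zero_mul, ← phi_eq] at hsum

theorem ne_zero_of_mem_galoisConjugates {β : ℝ} (hβ : β ≠ 0) {z : ℂ}
    (hz : z ∈ galoisConjugates β) : z ≠ 0 := by
  rintro rfl
  have h := hz.2.1
  exact hβ (by exact_mod_cast isConjRoot_zero_iff_eq_zero.mp h.symm)

/-! ### Closedness of the upper bound and the easy inclusions. -/

theorem GG_inter_closedBall_isCompact {r : ℝ} (hr : r < 1) :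
    IsCompact (GG (Set.Icc (-1 : ℝ) 1) ∩ Metric.closedBall 0 r) := by
  let K : Set ((ℕ → ℝ) × ℂ) := (Set.univ.pi fun _ => Set.Icc (-1 : ℝ) 1) ×ˢ Metric.closedBall 0 r
  have hK : IsCompact K :=
    (isCompact_univ_pi fun _ => isCompact_Icc).prod (isCompact_closedBall 0 r)
  have hbd : ∀ n (p : (ℕ → ℝ) × ℂ), p ∈ K → ‖(p.1 n : ℂ) * p.2 ^ n‖ ≤ |r| ^ n := by
    intro n p hp
    have h1 : |p.1 n| ≤ 1 := abs_le.mpr (hp.1 n trivial)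
    have h2 : ‖p.2‖ ≤ |r| := (by simpa using hp.2 : ‖p.2‖ ≤ r).trans (le_abs_self r)
    rw [norm_mul, norm_pow, Complex.norm_real, Real.norm_eq_abs]
    calc |p.1 n| * ‖p.2‖ ^ n ≤ 1 * |r| ^ n := by gcongr
      _ = |r| ^ n := one_mul _
  by_cases hr0 : r < 0
  · rw [Metric.closedBall_eq_empty.mpr hr0, Set.inter_empty]; exact isCompact_empty
  have hsr : Summable fun n : ℕ => |r| ^ n :=
    summable_geometric_of_lt_one (abs_nonneg r) (by rw [abs_of_nonneg (not_lt.mp hr0)]; exact hr)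
  have hcont : ContinuousOn (fun p : (ℕ → ℝ) × ℂ => ∑' n, (p.1 n : ℂ) * p.2 ^ n) K := by
    refine continuousOn_tsum (fun n => ?_) hsr hbd
    fun_prop
  -- The first component pins the constant coefficient to 1; all other coefficients range over the
  -- Tychonoff cube.
  have hcont2 : ContinuousOn
      (fun p : (ℕ → ℝ) × ℂ => (p.1 0, ∑' n, (p.1 n : ℂ) * p.2 ^ n)) K :=
    ContinuousOn.prodMk (by fun_prop) hcont
  have hcl : IsCompact (K ∩ (fun p : (ℕ → ℝ) × ℂ => (p.1 0, ∑' n, (p.1 n : ℂ) * p.2 ^ n)) ⁻¹'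
      {((1 : ℝ), (0 : ℂ))}) :=
    hK.of_isClosed_subset (hcont2.preimage_isClosed_of_isClosed hK.isClosed isClosed_singleton)
      Set.inter_subset_left
  convert hcl.image continuous_snd using 1
  ext z
  constructor
  · rintro ⟨⟨-, f, hf, hsum⟩, hzr⟩
    refine ⟨(fun n => PowerSeries.coeff n f, z), ⟨⟨fun n _ => ?_, hzr⟩, ?_⟩, rfl⟩
    · rcases Nat.eq_zero_or_pos n with rfl | hn
      · show PowerSeries.coeff 0 f ∈ _
        rw [hf.1]; norm_num
      · exact hf.2 n hn
    · exact Prod.ext hf.1 hsum.tsum_eq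
  · rintro ⟨⟨a, w⟩, ⟨⟨ha, hw⟩, hp⟩, rfl⟩
    obtain ⟨h0, h1⟩ := Prod.ext_iff.mp hp
    have hwr : ‖w‖ ≤ r := by simpa using hw
    exact ⟨mem_GG_of_hasSum h0 (fun n => abs_le.mpr (ha n trivial)) (hwr.trans_lt hr) h1, hw⟩

theorem isClosed_bigSet : IsClosed bigSet := by
  rw [← closure_subset_iff_isClosed, bigSet, closure_union, closure_closure]
  rintro w (hw | hw)
  · exact Or.inl hw
  rcases le_or_gt ‖w‖ 1 with h1 | h1
  · exact mem_bigSet_of_norm_le h1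
  have hw0 : w ≠ 0 := by rintro rfl; simp at h1; linarith
  have hwi : ‖w⁻¹‖ < 1 := by rw [norm_inv]; exact inv_lt_one_of_one_lt₀ h1
  have h2 : w⁻¹ ∈ closure (GG (Set.Icc (-1 : ℝ) 1)) := by
    have := mem_closure_image (f := fun z : ℂ => z⁻¹)
      (continuousAt_inv₀ hw0) hw
    rw [invSet, Set.image_image] at this
    simpa using this
  obtain ⟨r, hr1, hr2⟩ := exists_between hwi
  have h3 : w⁻¹ ∈ closure (GG (Set.Icc (-1 : ℝ) 1) ∩ Metric.closedBall 0 r) := by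
    rw [Set.inter_comm]
    refine closure_mono (Set.inter_subset_inter_left _ Metric.ball_subset_closedBall)
      (Metric.isOpen_ball.inter_closure ⟨?_, h2⟩)
    simpa using hr1
  rw [(GG_inter_closedBall_isCompact hr2).isClosed.closure_eq] at h3
  exact Or.inr ⟨w⁻¹, h3.1, inv_inv w⟩

theorem PhiHat_subset_bigSet (E : ℕ → Fin 2) : PhiHat E ⊆ bigSet :=
  closure_minimal (fun _ ⟨_, hβ, hz⟩ => mem_bigSet_of_mem_galoisConjugates hβ hz) isClosed_bigSet

theorem PhiStar_subset_bigSet (E : ℕ → Fin 2) : PhiStar E ⊆ bigSet :=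
  closure_minimal (fun _ ⟨_, hβ, _, hz, hne, hw⟩ =>
    hw ▸ inv_mem_bigSet_of_isZeroOf hβ.1 hz hne) isClosed_bigSet

theorem Phi_subset_PhiHat (E : ℕ → Fin 2) : Phi E ⊆ PhiHat E :=
  closure_mono fun _ ⟨β, hβ, hz⟩ => ⟨β, hβ.isGenParry, hz⟩

theorem Phi_subset_PhiStar (E : ℕ → Fin 2) : Phi E ⊆ PhiStar E := by
  refine closure_mono fun z ⟨β, hβ, hz⟩ => ⟨β, hβ.1, z⁻¹, ?_, ?_, (inv_inv z).symm⟩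
  · have hβ0 : β ≠ 0 := by have := hβ.1.1; positivity
    exact isZeroOf_inv_of_mem_galoisConjugates hβ hz (ne_zero_of_mem_galoisConjugates hβ0 hz)
  · exact fun h => hz.2.2 (inv_injective h)

/-! ### The alternating map, Horner algebra and irreducibility. -/

/-- For `E_alt`, the map `τ` measures the distance of `β x` from the even integers. -/
theorem tau_Ealt_abs {β u : ℝ} (hβ : 0 ≤ β) (m : ℤ) (h : |β * u - 2 * m| < 1) :
    tau β Ealt |u| = |β * u - 2 * m| := by
  wlog hu : 0 ≤ u generalizing u m
  · have e : β * -u - 2 * ((-m : ℤ) : ℝ) = -(β * u - 2 * m) := by push_cast; ring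
    have := this (u := -u) (-m) (by rw [e, abs_neg]; exact h) (by linarith)
    rwa [e, abs_neg, abs_neg] at this
  rw [abs_of_nonneg hu]
  have hbu : 0 ≤ β * u := mul_nonneg hβ hu
  have hbr : ((branch β u : ℕ) : ℤ) = ⌊β * u⌋ :=
    Int.natCast_floor_eq_floor hbu
  obtain ⟨h1, h2⟩ := abs_lt.mp h
  rcases le_or_gt 0 (β * u - 2 * m) with h0 | h0
  · have hfl : ⌊β * u⌋ = 2 * m := by
      rw [Int.floor_eq_iff]; push_cast; constructor <;> linarith
    have hev : Even (branch β u) := by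
      rw [← Int.even_coe_nat, hbr, hfl]; exact even_two_mul m
    rw [abs_of_nonneg h0, tau]
    simp [Ealt, hev, Int.fract, hfl]
  · have hfl : ⌊β * u⌋ = 2 * m - 1 := by
      rw [Int.floor_eq_iff]; push_cast; constructor <;> linarith
    have hev : ¬ Even (branch β u) := by
      rw [← Int.even_coe_nat, hbr, hfl, Int.not_even_iff_odd]; exact ⟨m - 1, by ring⟩
    rw [abs_of_neg h0, tau]
    simp [Ealt, hev, Int.fract, hfl]
    ring

section Horner

variable {R : Type*} [CommRing R]

theorem horner_monic [Nontrivial R] (c : ℕ → R) (n : ℕ) :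
    (horner c n).Monic ∧ (horner c n).natDegree = n := by
  induction n with
  | zero => simp [horner]
  | succ n ih =>
    have hm : (Polynomial.X * horner c n).Monic := Polynomial.monic_X.mul ih.1
    have hd : (Polynomial.X * horner c n).natDegree = n + 1 := by
      rw [Polynomial.monic_X.natDegree_mul ih.1, ih.2, Polynomial.natDegree_X, add_comm]
    have hlt : (Polynomial.C (c n)).degree < (Polynomial.X * horner c n).degree := by
      rw [Polynomial.degree_eq_natDegree hm.ne_zero, hd]
      exact Polynomial.degree_C_le.trans_lt (by exact_mod_cast Nat.succ_pos n)
    refine ⟨hm.sub_of_left hlt, ?_⟩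
    rw [horner, Polynomial.natDegree_sub_C, hd]

theorem map_horner {S : Type*} [CommRing S] (f : R →+* S) (c : ℕ → R) (n : ℕ) :
    (horner c n).map f = horner (fun i => f (c i)) n := by
  induction n with
  | zero => simp [horner]
  | succ n ih => simp [horner, ih]

theorem horner_zero (n : ℕ) : horner (fun _ => (0 : R)) n = Polynomial.X ^ n := by
  induction n with
  | zero => simp [horner]
  | succ n ih => simp [horner, ih, pow_succ']

theorem horner_congr {c c' : ℕ → R} {n : ℕ} (h : ∀ i < n, c i = c' i) :
    horner c n = horner c' n := by
  induction n with
  | zero => rfl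
  | succ n ih => rw [horner, horner, ih fun i hi => h i (by omega), h n (by omega)]

/-- Division of a Horner polynomial by `X - b`. -/
theorem eval_horner_succ (c : ℕ → R) (b w : R) (n : ℕ) :
    (horner c (n + 1)).eval w =
      (w - b) * (horner (fun i => -(horner c (i + 1)).eval b) n).eval w +
        (horner c (n + 1)).eval b := by
  induction n with
  | zero => simp [horner]
  | succ n ih =>
    rw [horner, Polynomial.eval_sub, Polynomial.eval_mul, Polynomial.eval_X, ih]
    simp only [horner, Polynomial.eval_sub, Polynomial.eval_mul, Polynomial.eval_X,
      Polynomial.eval_C]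
    ring

/-- Passes from roots of monic polynomials to zeros of truncated power series at the reciprocal. -/
theorem eval_horner_eq {K : Type*} [Field K] (c : ℕ → K) {w : K} (hw : w ≠ 0) (n : ℕ) :
    (horner c n).eval w = w ^ n * (1 - ∑ i ∈ Finset.range n, c i * w⁻¹ ^ (i + 1)) := by
  induction n with
  | zero => simp [horner]
  | succ n ih =>
    rw [horner, Polynomial.eval_sub, Polynomial.eval_mul, Polynomial.eval_X, ih,
      Finset.sum_range_succ, Polynomial.eval_C, inv_pow]
    field_simp
    ring

end Horner

/-- Eisenstein's criterion at `2` for Horner polynomials. -/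
theorem horner_irreducible {c : ℕ → ℤ} {N : ℕ} (hc : ∀ n, 2 ∣ c n) (hN : ¬ 4 ∣ c N) :
    Irreducible (horner c (N + 1)) := by
  obtain ⟨hm, hd⟩ := horner_monic c (N + 1)
  have hp : (Ideal.span {(2 : ℤ)}).IsPrime :=
    (Ideal.span_singleton_prime two_ne_zero).mpr Int.prime_two
  refine Polynomial.irreducible_of_eisenstein_criterion hp ?_ ?_ ?_ ?_ hm.isPrimitive
  · rw [hm.leadingCoeff, Ideal.mem_span_singleton]; norm_num
  · intro n hn
    rw [Polynomial.degree_eq_natDegree hm.ne_zero, hd] at hn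
    have hn' : n < N + 1 := by exact_mod_cast hn
    rw [Ideal.mem_span_singleton]
    have h2 := map_horner (Int.castRingHom (ZMod 2)) c (N + 1)
    have h0 : (fun i => Int.castRingHom (ZMod 2) (c i)) = fun _ => 0 := by
      funext i
      exact (ZMod.intCast_zmod_eq_zero_iff_dvd (c i) 2).mpr (hc i)
    rw [h0, horner_zero] at h2
    have h3 := congrArg (fun p => Polynomial.coeff p n) h2
    simp only [Polynomial.coeff_map, Polynomial.coeff_X_pow, if_neg hn'.ne] at h3
    exact (ZMod.intCast_zmod_eq_zero_iff_dvd _ 2).mp h3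
  · rw [Polynomial.degree_eq_natDegree hm.ne_zero, hd]
    exact_mod_cast Nat.succ_pos N
  · rw [Ideal.span_singleton_pow, Ideal.mem_span_singleton]
    simp only [horner, Polynomial.coeff_sub, Polynomial.mul_coeff_zero, Polynomial.coeff_X_zero,
      zero_mul, Polynomial.coeff_C_zero, zero_sub, dvd_neg]
    norm_num
    exact hN

theorem isConjRoot_of_irreducible {p : Polynomial ℤ} (hp : Irreducible p) (hm : p.Monic) {β : ℝ}
    (hβ : Polynomial.aeval β p = 0) {w : ℂ} (hw : Polynomial.aeval w p = 0) (hne : w ≠ β) :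
    w ∈ galoisConjugates β := by
  have hirr : Irreducible (p.map (algebraMap ℤ ℚ)) :=
    (hm.irreducible_iff_irreducible_map_fraction_map).mp hp
  have hm' : (p.map (algebraMap ℤ ℚ)).Monic := hm.map _
  have hβ' : Polynomial.aeval (β : ℂ) p = 0 := by
    have h2 : Polynomial.aeval (algebraMap ℝ ℂ β) p = 0 := by
      rw [Polynomial.aeval_algebraMap_apply, hβ, map_zero]
    exact h2
  refine ⟨⟨_, hm'.ne_zero, by rwa [Polynomial.aeval_map_algebraMap]⟩, ?_, hne⟩
  rw [IsConjRoot,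
    ← minpoly.eq_of_irreducible_of_monic hirr
      (by rwa [Polynomial.aeval_map_algebraMap]) hm',
    ← minpoly.eq_of_irreducible_of_monic hirr
      (by rwa [Polynomial.aeval_map_algebraMap]) hm']

theorem eval_horner_sub_le {b b' : ℕ → ℂ} {N : ℕ} {δ : ℝ} (h : ∀ n < N, ‖b n - b' n‖ ≤ δ) (w : ℂ) :
    ‖(horner b N).eval w - (horner b' N).eval w‖ ≤ δ * ∑ i ∈ Finset.range N, ‖w‖ ^ i := by
  induction N with
  | zero => simp [horner]
  | succ N ih =>
    have e : (horner b (N + 1)).eval w - (horner b' (N + 1)).eval w =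
        w * ((horner b N).eval w - (horner b' N).eval w) - (b N - b' N) := by
      simp only [horner, Polynomial.eval_sub, Polynomial.eval_mul, Polynomial.eval_X,
        Polynomial.eval_C]
      ring
    rw [e, geom_sum_succ]
    have h1 := ih fun n hn => h n (by omega)
    calc _ ≤ ‖w‖ * ‖(horner b N).eval w - (horner b' N).eval w‖ + ‖b N - b' N‖ := by
          rw [← norm_mul]; exact norm_sub_le _ _
      _ ≤ ‖w‖ * (δ * ∑ i ∈ Finset.range N, ‖w‖ ^ i) + δ := by
          gcongr
          exact h N (by omega)
      _ = _ := by ring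

/-- A monic polynomial with a small value at `w` has a root near `w`. -/
theorem exists_root_near {p : Polynomial ℂ} (hp : p.Monic) {w : ℂ} {ε : ℝ} (hε : 0 ≤ ε)
    (h : ‖p.eval w‖ < ε ^ p.natDegree) : ∃ z, p.eval z = 0 ∧ ‖w - z‖ < ε := by
  by_contra! hcon
  have hs := IsAlgClosed.splits p
  have hprod := hs.eq_prod_roots_of_monic hp
  have hcard : p.roots.card = p.natDegree := hs.natDegree_eq_card_roots.symm
  have hval : ‖p.eval w‖ = (p.roots.map fun a => ‖w - a‖).prod := by
    conv_lhs => rw [hprod]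
    rw [Polynomial.eval_multiset_prod, Multiset.map_map]
    refine (map_multiset_prod (normHom (α := ℂ)) _).trans ?_
    rw [Multiset.map_map]
    simp [normHom]
  have hle : (p.roots.map fun _ => ε).prod ≤ (p.roots.map fun a => ‖w - a‖).prod := by
    refine Multiset.prod_map_le_prod_map₀ _ _ (fun _ _ => hε) fun a ha => ?_
    exact hcon a (Polynomial.isRoot_of_mem_roots ha)
  rw [Multiset.map_const', Multiset.prod_replicate, hcard] at hle
  linarith

/-! ### Shadowing a prescribed coefficient sequence. -/

/-- Simple numbers for `E_alt` whose signed orbit shadows a prescribed finite sequence and whose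
conjugates are the zeros of the polynomial formed from the signed orbit. -/
theorem exists_simple_shadowing {N : ℕ} (hN : 1 ≤ N) {a : ℕ → ℝ} (ha : ∀ n, |a n| ≤ 1) {δ : ℝ}
    (hδ : 0 < δ) (B : ℝ) :
    ∃ β : ℝ, B < β ∧ IsSimple β Ealt ∧ ∃ b : ℕ → ℝ, (∀ n < N, |b n - a n| ≤ δ) ∧
      ∀ w : ℂ, (horner (fun n => (b n : ℂ)) N).eval w = 0 → w ≠ β → w ∈ galoisConjugates β := by
  obtain ⟨K, hK⟩ := exists_nat_gt (max (max 4 (B + 1)) (12 / δ + 1))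
  have hK4 : (4 : ℝ) < K := (le_max_left _ _).trans_lt ((le_max_left _ _).trans_lt hK)
  have hKB : B + 1 < K := (le_max_right _ _).trans_lt ((le_max_left _ _).trans_lt hK)
  have hKδ : 12 / δ + 1 < K := (le_max_right _ _).trans_lt hK
  -- The root will be near `2K`, and `q (n+1) β ≈ c (n+1) / β ≈ -a n`. Being `2` modulo `4` serves
  -- Eisenstein and keeps `c (n+1)` nonzero; `K - 4` instead of `K` keeps `|c (n+1)|` safely below
  -- `β`.
  set c : ℕ → ℤ := fun n => if n = 0 then 2 * K else
    4 * ⌊((K : ℝ) - 4) * (-a (n - 1)) / 2⌋ + 2 with hc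
  have hc0 : c 0 = 2 * K := by simp [hc]
  have hcs : ∀ n, c (n + 1) = 4 * ⌊((K : ℝ) - 4) * (-a n) / 2⌋ + 2 := by intro n; simp [hc]
  have hceven : ∀ n, ∃ m, c n = 2 * m := by
    rintro (_ | n)
    · exact ⟨K, hc0⟩
    · exact ⟨2 * ⌊((K : ℝ) - 4) * (-a n) / 2⌋ + 1, by rw [hcs]; ring⟩
  have hc4 : ∀ n, ¬ 4 ∣ c (n + 1) := by intro n; rw [hcs]; omega
  have hcapp : ∀ n, |(c (n + 1) : ℝ) - 2 * (K - 4) * (-a n)| ≤ 2 := by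
    intro n
    rw [hcs]
    have h1 := Int.floor_le (((K : ℝ) - 4) * (-a n) / 2)
    have h2 := Int.lt_floor_add_one (((K : ℝ) - 4) * (-a n) / 2)
    push_cast
    rw [abs_le]; constructor <;> linarith
  have hcbd : ∀ n, |(c (n + 1) : ℝ)| ≤ 2 * K - 6 := by
    intro n
    have h1 := abs_sub_abs_le_abs_sub (c (n + 1) : ℝ) (2 * (K - 4) * (-a n))
    have h2 : |2 * ((K : ℝ) - 4) * (-a n)| ≤ 2 * (K - 4) := by
      rw [abs_mul, abs_neg, abs_of_pos (by linarith)]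
      exact mul_le_of_le_one_right (by linarith) (ha n)
    linarith [hcapp n]
  set q : ℕ → ℝ → ℝ := fun n x => Polynomial.aeval x (horner c n) with hq
  have hq0 : ∀ x, q 0 x = 1 := by intro x; simp [hq, horner]
  have hqs : ∀ n x, q (n + 1) x = x * q n x - c n := by intro n x; simp [hq, horner]
  have hq1 : ∀ x, q 1 x = x - 2 * K := by intro x; rw [hqs, hq0, hc0]; push_cast; ring
  have hup : ∀ n, 1 ≤ q (n + 1) (2 * K + 1) := by
    intro n
    induction n with
    | zero => rw [zero_add, hq1]; linarith
    | succ n ih =>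
      rw [hqs]
      have := (abs_le.mp (hcbd n)).2
      nlinarith
  have hlo : ∀ n, q (n + 1) (2 * K - 1) ≤ -1 := by
    intro n
    induction n with
    | zero => rw [zero_add, hq1]; linarith
    | succ n ih =>
      rw [hqs]
      have := (abs_le.mp (hcbd n)).1
      nlinarith
  obtain ⟨β, ⟨hβ1, hβ2⟩, hβ0⟩ : ∃ β ∈ Set.Icc (2 * (K : ℝ) - 1) (2 * K + 1), q (N + 1) β = 0 := by
    have hcont : ContinuousOn (q (N + 1)) (Set.Icc (2 * (K : ℝ) - 1) (2 * K + 1)) :=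
      (Polynomial.continuous_aeval (horner c (N + 1))).continuousOn
    exact intermediate_value_Icc (by linarith) hcont
      ⟨by linarith [hlo N], by linarith [hup N]⟩
  -- Once `|q n β| ≥ 1`, it stays so because `β - |c m| ≥ 1` for `m ≥ 1`, contradicting `q (N + 1) β
  -- = 0`.
  have hsmall : ∀ n, 1 ≤ n → n ≤ N + 1 → |q n β| < 1 := by
    intro n hn hnN
    by_contra! hcon
    have hgrow : ∀ m, n ≤ m → 1 ≤ |q m β| := by
      intro m hm
      induction m, hm using Nat.le_induction with
      | base => exact hcon
      | succ m hm ih =>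
        obtain ⟨j, rfl⟩ : ∃ j, m = j + 1 := ⟨m - 1, by omega⟩
        rw [hqs]
        have h1 := abs_sub_abs_le_abs_sub (β * q (j + 1) β) (c (j + 1))
        rw [abs_mul, abs_of_pos (by linarith : 0 < β)] at h1
        have h2 := hcbd j
        nlinarith
    have := hgrow (N + 1) hnN
    rw [hβ0, abs_zero] at this
    linarith
  have horb : ∀ n, n ≤ N → orbit β Ealt n = |q n β| := by
    intro n hn
    induction n with
    | zero => simp [orbit, hq0]
    | succ n ih =>
      obtain ⟨m, hm⟩ := hceven n
      have hcm : (c n : ℝ) = 2 * m := by rw [hm]; push_cast; ring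
      have h1 := hsmall (n + 1) (by omega) (by omega)
      rw [orbit_succ, ih (by omega)]
      rw [hqs, hcm] at h1 ⊢
      exact tau_Ealt_abs (by linarith) m h1
  obtain ⟨M, rfl⟩ : ∃ M, N = M + 1 := ⟨N - 1, by omega⟩
  have hlast : β * q (M + 1) β = c (M + 1) := by
    have := hqs (M + 1) β
    rw [hβ0] at this
    linarith
  have hcne : c (M + 1) ≠ 0 := fun h => hc4 M (h ▸ dvd_zero 4)
  have hlt := hsmall (M + 1) (by omega) (by omega)
  have hβpos : 0 < β := by linarith
  have hadm : Admissible β := by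
    refine ⟨by linarith, fun m hm => ?_⟩
    have hint : q (M + 1) β = (((horner c (M + 1)).eval m : ℤ) : ℝ) := by
      rw [hm]
      exact Polynomial.aeval_algebraMap_apply ℝ m (horner c (M + 1))
    have hz : (horner c (M + 1)).eval m = 0 := by
      rw [hint] at hlt
      exact Int.abs_lt_one_iff.mp (by exact_mod_cast hlt)
    rw [hint, hz] at hlast
    apply hcne
    have : (c (M + 1) : ℝ) = 0 := by rw [← hlast]; simp
    exact_mod_cast this
  have habs : β * |q (M + 1) β| = ((c (M + 1)).natAbs : ℝ) := by
    rw [Nat.cast_natAbs, Int.cast_abs, ← hlast, abs_mul, abs_of_pos hβpos]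
  have hsimple : IsSimple β Ealt := by
    refine ⟨hadm, M + 1, by omega, (c (M + 1)).natAbs, Int.natAbs_pos.mpr hcne, ?_, ?_⟩
    · rw [Nat.le_floor_iff hβpos.le, ← habs]
      nlinarith
    · rw [horb _ le_rfl, ← habs]; field_simp
  refine ⟨β, by linarith, hsimple, fun n => -q (n + 1) β, ?_, ?_⟩
  · intro n hn
    have h1 := hsmall (n + 2) (by omega) (by omega)
    rw [show n + 2 = (n + 1) + 1 from rfl, hqs] at h1
    have h2 := hcapp n
    have h3 : |(2 * ((K : ℝ) - 4) - β) * (-a n)| ≤ 9 := by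
      rw [abs_mul, abs_neg]
      have : |2 * ((K : ℝ) - 4) - β| ≤ 9 := by rw [abs_le]; constructor <;> linarith
      nlinarith [abs_nonneg (a n), ha n, abs_nonneg (2 * ((K : ℝ) - 4) - β)]
    -- `12 = 1 + 2 + 9`: the next Horner value, the rounding in `c`, and the gap between `β` and `2
    -- (K - 4)`.
    have h4 : |β * (-q (n + 1) β - a n)| ≤ 12 := by
      rw [abs_lt] at h1
      rw [abs_le] at h2 h3 ⊢
      constructor <;> linarith
    rw [abs_mul, abs_of_pos hβpos] at h4
    have h5 : 12 ≤ β * δ := by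
      have : 12 / δ ≤ β := by linarith
      rwa [div_le_iff₀ hδ] at this
    exact le_of_mul_le_mul_left (h4.trans h5) hβpos
  · intro w hw hne
    refine isConjRoot_of_irreducible (horner_irreducible (fun n => ?_) (hc4 M))
      (horner_monic c _).1 hβ0 ?_ hne
    · obtain ⟨m, hm⟩ := hceven n
      exact ⟨m, hm⟩
    · have hmap : ∀ (n : ℕ) (x : ℂ), Polynomial.aeval x (horner c n) =
          (horner (fun i => (c i : ℂ)) n).eval x := by
        intro n x
        rw [Polynomial.aeval_def, ← Polynomial.eval_map, map_horner]
        simp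
      have hqc : ∀ n, (horner (fun i => (c i : ℂ)) n).eval (β : ℂ) = (q n β : ℂ) := by
        intro n
        rw [← hmap]
        exact Polynomial.aeval_algebraMap_apply ℂ β (horner c n)
      rw [hmap, eval_horner_succ _ (β : ℂ), hqc, hβ0]
      simp only [hqc]
      push_cast at hw
      rw [hw]
      simp

/-- Zeros of monic polynomials with coefficients in `[-1,1]` belong to `Φ(E_alt)`. -/
theorem mem_Phi_Ealt_of_root {N : ℕ} (hN : 1 ≤ N) {a : ℕ → ℝ} (ha : ∀ n < N, |a n| ≤ 1) {w : ℂ}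
    (hw : (horner (fun n => (a n : ℂ)) N).eval w = 0) : w ∈ Phi Ealt := by
  wlog ha' : ∀ n, |a n| ≤ 1 generalizing a
  · refine this (a := fun n => if n < N then a n else 0) (fun n hn => ?_) ?_ fun n => ?_
    · simpa [hn] using ha n hn
    · rw [← hw]
      congr 1
      exact horner_congr fun i hi => by simp [hi]
    · split_ifs with h
      · exact ha n h
      · simp
  refine Metric.mem_closure_iff.mpr fun ε hε => ?_
  set S := ∑ i ∈ Finset.range N, ‖w‖ ^ i with hS
  have hS0 : 0 ≤ S := Finset.sum_nonneg fun _ _ => by positivity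
  -- This `δ` makes the perturbed value at `w` smaller than `ε ^ N`; the bound `‖w‖ + ε < β` ensures
  -- that the nearby root is not `β`.
  obtain ⟨β, hβ, hsimple, b, hb, hconj⟩ := exists_simple_shadowing hN ha'
    (δ := ε ^ N / (2 * (S + 1))) (by positivity) (‖w‖ + ε)
  obtain ⟨hm, hd⟩ := horner_monic (fun n => (b n : ℂ)) N
  have hlt : ‖(horner (fun n => (b n : ℂ)) N).eval w‖ < ε ^ N := by
    have h1 := eval_horner_sub_le (b := fun n => (b n : ℂ)) (b' := fun n => (a n : ℂ))
      (δ := ε ^ N / (2 * (S + 1))) (N := N) (fun n hn => by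
        rw [← Complex.ofReal_sub, Complex.norm_real]; exact hb n hn) w
    rw [hw, sub_zero, ← hS] at h1
    refine h1.trans_lt ?_
    rw [div_mul_eq_mul_div, div_lt_iff₀ (by positivity)]
    have : 0 < ε ^ N := by positivity
    nlinarith
  obtain ⟨z, hz, hzw⟩ := exists_root_near hm hε.le (by rwa [hd])
  refine ⟨z, ⟨β, hsimple, hconj z hz ?_⟩, by rwa [dist_eq_norm]⟩
  rintro rfl
  have h1 : ‖(β : ℂ)‖ ≤ ‖w‖ + ‖w - β‖ := by
    have := norm_sub_le w (w - β)
    simpa using this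
  rw [Complex.norm_real, Real.norm_eq_abs] at h1
  linarith [le_abs_self β]

/-! ### Lower bound: the disk and the reciprocal zeros. -/

/-- Real coordinates of `s` with respect to `1, z`. -/
theorem real_combination {z s : ℂ} (h : z.im = 0 → s.im = 0) :
    ((s.re - s.im / z.im * z.re : ℝ) : ℂ) + ((s.im / z.im : ℝ) : ℂ) * z = s := by
  apply Complex.ext
  · simp
  -- For real `z` the quotient `s.im / z.im` takes the default value `0`, and `s` is real.
  · by_cases hz : z.im = 0
    · simp [hz, h hz]
    · simp [hz]

open Filter Topology in
theorem eventually_coordinates_small (z : ℂ) {s : ℕ → ℂ} (hs : Tendsto s atTop (𝓝 0)) {η : ℝ}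
    (hη : 0 < η) :
    ∀ᶠ n in atTop, |(s n).re - (s n).im / z.im * z.re| < η ∧ |(s n).im / z.im| < η := by
  have h1 : Continuous fun s : ℂ => |s.re - s.im / z.im * z.re| := by fun_prop
  have h2 : Continuous fun s : ℂ => |s.im / z.im| := by fun_prop
  have t1 := (h1.tendsto 0).comp hs
  have t2 := (h2.tendsto 0).comp hs
  simp only [Complex.zero_re, Complex.zero_im, zero_div, zero_mul, sub_zero, abs_zero] at t1 t2
  exact (t1.eventually_lt_const hη).and (t2.eventually_lt_const hη)

theorem im_eq_zero_of_pow {w : ℂ} (h : w.im = 0) (n : ℕ) : (w ^ n).im = 0 := by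
  rw [← Complex.conj_eq_iff_im] at h ⊢
  rw [map_pow, h]

open Filter Topology in
-- High powers of `w` are small, so `w ^ (M + 2) = d₁ + d₂ w` with real `|d₁|, |d₂| < 1`, and `w` is
-- a root of `X ^ (M + 2) - d₂ X - d₁`.
theorem ball_subset_Phi_Ealt : Metric.ball (0 : ℂ) 1 ⊆ Phi Ealt := by
  intro w hw
  have hw1 : ‖w‖ < 1 := by simpa using hw
  have ht : Tendsto (fun n : ℕ => w ^ (n + 2)) atTop (𝓝 0) :=
    (tendsto_add_atTop_iff_nat 2).mpr (tendsto_pow_atTop_nhds_zero_of_norm_lt_one hw1)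
  obtain ⟨M, h1, h2⟩ := (eventually_coordinates_small w ht one_pos).exists
  set s := w ^ (M + 2) with hs
  have hcomb := real_combination (z := w) (s := s) fun h => im_eq_zero_of_pow h _
  set d₁ := s.re - s.im / w.im * w.re
  set d₂ := s.im / w.im
  refine mem_Phi_Ealt_of_root (N := M + 2) (by omega)
    (a := fun n => if n < M then 0 else if n = M then d₂ else d₁) (fun n _ => ?_) ?_
  · split_ifs
    · simp
    · exact h2.le
    · exact h1.le
  · have h0 : horner (fun n => (((if n < M then 0 else if n = M then d₂ else d₁ : ℝ)) : ℂ)) M =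
        Polynomial.X ^ M := by
      rw [← horner_zero]
      exact horner_congr fun i hi => by simp [hi]
    simp only [horner, h0]
    simp
    rw [← sub_eq_zero.mpr hcomb.symm, hs]
    ring

open Filter Topology in
/-- If `1 + ∑ bₙ zⁿ = 0` with `|bₙ|` bounded away from `1`, then `z⁻¹ ∈ Φ(E_alt)`. -/
theorem inv_mem_Phi_Ealt_of_slack {z : ℂ} (hz0 : z ≠ 0) {b : ℕ → ℝ} {η : ℝ} (hη : 0 < η)
    (hb : ∀ n, |b n| ≤ 1 - η) (hsum : HasSum (fun n => (b n : ℂ) * z ^ (n + 1)) 1) :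
    z⁻¹ ∈ Phi Ealt := by
  have ht0 := hsum.tendsto_sum_nat
  have ht : Tendsto (fun N => (1 - ∑ i ∈ Finset.range N, (b i : ℂ) * z ^ (i + 1)) / z) atTop
      (𝓝 0) := by
    simpa using (ht0.const_sub 1).div_const z
  obtain ⟨N, ⟨h1, h2⟩, hN⟩ :=
    ((eventually_coordinates_small z ht hη).and (eventually_ge_atTop 2)).exists
  -- The truncation error is `s z = d₁ z + d₂ z²`; the slack `η` lets the first two coefficients
  -- absorb it.
  set s := (1 - ∑ i ∈ Finset.range N, (b i : ℂ) * z ^ (i + 1)) / z with hs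
  have hcomb := real_combination (z := z) (s := s) fun h => by
    have hzr : z = (z.re : ℂ) := Complex.ext (by simp) (by simp [h])
    have : s = (((1 - ∑ i ∈ Finset.range N, b i * z.re ^ (i + 1)) / z.re : ℝ) : ℂ) := by
      rw [hs, hzr]; push_cast; simp
    rw [this, Complex.ofReal_im]
  set d₁ := s.re - s.im / z.im * z.re
  set d₂ := s.im / z.im
  refine mem_Phi_Ealt_of_root (N := N) (by omega)
    (a := fun n => b n + if n = 0 then d₁ else if n = 1 then d₂ else 0) (fun n _ => ?_) ?_
  · refine (abs_add_le _ _).trans ?_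
    have : |if n = 0 then d₁ else if n = 1 then d₂ else 0| ≤ η := by
      split_ifs
      · exact h1.le
      · exact h2.le
      · simpa using hη.le
    linarith [hb n]
  · rw [eval_horner_eq _ (inv_ne_zero hz0), inv_inv]
    refine mul_eq_zero_of_right _ ?_
    have hd : ∑ i ∈ Finset.range N,
        (((if i = 0 then d₁ else if i = 1 then d₂ else 0 : ℝ)) : ℂ) * z ^ (i + 1) = s * z := by
      obtain ⟨M, rfl⟩ : ∃ M, N = M + 2 := ⟨N - 2, by omega⟩
      rw [Finset.sum_range_succ', Finset.sum_range_succ', Finset.sum_eq_zero, ← hcomb]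
      · simp; ring
      · intro i _; simp
    have hsz : s * z = 1 - ∑ i ∈ Finset.range N, (b i : ℂ) * z ^ (i + 1) := by
      rw [hs]; field_simp
    simp only [Complex.ofReal_add, add_mul, Finset.sum_add_distrib]
    rw [hd, hsz]
    ring

open Filter Topology in
-- Scaling the coefficients by `t ^ n` with `t < 1` creates slack `1 - t` and moves the zero to `z /
-- t`; then `t → 1`.
theorem invSet_GG_subset_Phi_Ealt : invSet (GG (Set.Icc (-1 : ℝ) 1)) ⊆ Phi Ealt := by
  rintro _ ⟨z, ⟨hz, f, ⟨hf0, hf⟩, hsum⟩, rfl⟩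
  have hz1 : ‖z‖ < 1 := by simpa using hz
  have hz0 : z ≠ 0 := by
    rintro rfl
    have h1 := hasSum_single (f := fun n : ℕ => ((PowerSeries.coeff n f : ℝ) : ℂ) * 0 ^ n) 0
      (fun n hn => by simp [hn])
    have := hsum.unique h1
    simp [hf0] at this
  have hsum' : HasSum (fun n => ((-PowerSeries.coeff (n + 1) f : ℝ) : ℂ) * z ^ (n + 1)) 1 := by
    have h1 := ((hasSum_nat_add_iff' 1).mpr hsum).neg
    simp [hf0] at h1
    simpa using h1
  have hev : ∀ᶠ t : ℝ in 𝓝[<] 1, t * z⁻¹ ∈ Phi Ealt := by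
    filter_upwards [Ioo_mem_nhdsLT (show (0 : ℝ) < 1 from one_pos)] with t ht
    have ht0 : (t : ℂ) ≠ 0 := by exact_mod_cast ht.1.ne'
    have h2 := inv_mem_Phi_Ealt_of_slack (z := z / t) (div_ne_zero hz0 ht0)
      (b := fun n => -PowerSeries.coeff (n + 1) f * t ^ (n + 1)) (η := 1 - t) (by linarith [ht.2])
      (fun n => ?_) ?_
    · rwa [inv_div, div_eq_mul_inv] at h2
    · have h3 : |PowerSeries.coeff (n + 1) f| ≤ 1 := abs_le.mpr (hf (n + 1) (by omega))
      have h4 : t ^ (n + 1) ≤ t := pow_le_of_le_one ht.1.le ht.2.le (by omega)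
      have h5 : 0 < t ^ (n + 1) := pow_pos ht.1 _
      rw [abs_mul, abs_neg, abs_of_pos h5]
      nlinarith
    · convert hsum' using 2 with n
      rw [div_pow]
      push_cast
      field_simp
  have htend : Tendsto (fun t : ℝ => (t : ℂ) * z⁻¹) (𝓝[<] 1) (𝓝 z⁻¹) := by
    have : Continuous fun t : ℝ => (t : ℂ) * z⁻¹ := by fun_prop
    simpa using (this.tendsto 1).mono_left nhdsWithin_le_nhds
  exact isClosed_closure.mem_of_tendsto htend hev

theorem bigSet_subset_Phi_Ealt : bigSet ⊆ Phi Ealt :=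
  Set.union_subset (closure_minimal ball_subset_Phi_Ealt isClosed_closure)
    invSet_GG_subset_Phi_Ealt

end GenBeta

theorem theorem2p5 :
    GenBeta.Phi GenBeta.Ealt = GenBeta.PhiHat GenBeta.Ealt ∧
    GenBeta.PhiHat GenBeta.Ealt = GenBeta.PhiStar GenBeta.Ealt ∧
    GenBeta.PhiStar GenBeta.Ealt =
      closure (Metric.ball (0 : ℂ) 1) ∪ GenBeta.invSet (GenBeta.GG (Set.Icc (-1 : ℝ) 1)) ∧
    GenBeta.Phi GenBeta.Ealt = ⋃ E : ℕ → Fin 2, GenBeta.Phi E := by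
  have hPhi (E : ℕ → Fin 2) : GenBeta.Phi E ⊆ GenBeta.bigSet :=
    (GenBeta.Phi_subset_PhiHat E).trans (GenBeta.PhiHat_subset_bigSet E)
  have h1 : GenBeta.Phi GenBeta.Ealt = GenBeta.bigSet :=
    (hPhi _).antisymm GenBeta.bigSet_subset_Phi_Ealt
  have h2 : GenBeta.PhiHat GenBeta.Ealt = GenBeta.bigSet :=
    (GenBeta.PhiHat_subset_bigSet _).antisymm (h1 ▸ GenBeta.Phi_subset_PhiHat _)
  have h3 : GenBeta.PhiStar GenBeta.Ealt = GenBeta.bigSet :=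
    (GenBeta.PhiStar_subset_bigSet _).antisymm (h1 ▸ GenBeta.Phi_subset_PhiStar _)
  refine ⟨h1.trans h2.symm, h2.trans h3.symm, h3, ?_⟩
  refine (Set.subset_iUnion GenBeta.Phi GenBeta.Ealt).antisymm (Set.iUnion_subset fun E => ?_)
  rw [h1]
  exact hPhi E
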